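/- **Definitions.** An $\mathbf{O}$-category is a category in which every hom-set is a dcpo (a partial order in which every nonempty directed subset has a supremum) and composition is Scott-continuous; products of $\mathbf{O}$-categories carry the componentwise order. A functor between $\mathbf{O}$-categories is locally continuous if its action on every hom-set is Scott-continuous. An embedding is a morphism $e : X \to Y$ for which there is a (necessarily unique) $e^p : Y \to X$ with $e^p \circ e = \mathrm{id}_X$ and $e \circ e^p \sqsubseteq \mathrm{id}_Y$. An $\mathbf{O}$-colimit of an $\omega$-chain of embeddings is a cocone $\kappa$ of embeddings with nadir $X$, say, such that $(\kappa_n \circ \kappa_n^p)_n$ is an ascending chain with supremum $\mathrm{id}_X$. An $\mathbf{O}$-category supports canonical fixed points if it has an initial object $\bot$, it has zero morphisms, each of which is the least element of its hom-set, and every $\omega$-chain of embeddings in it has an $\mathbf{O}$-colimit. This property passes to products of two such categories. Let $\mathbf{E}$ support canonical fixed points, and fix a choice of an initial object and of an $\mathbf{O}$-colimit for every $\omega$-chain of embeddings in $\mathbf{E}$. For an $\mathbf{O}$-category $\mathbf{D}$ and a locally continuous $F : \mathbf{D} \times \mathbf{E} \to \mathbf{E}$, the dagger $F^\dagger : \mathbf{D}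 \to \mathbf{E}$ is the following locally continuous functor. It sends an object $D$ to the chosen $\mathbf{O}$-colimit of $\bot \to F_D\bot \to F_D^2\bot \to \cdots$, where $F_D = F(D,-)$. It sends $f : D \to D'$ to $\bigsqcup_n \gamma_n \circ \eta^{(n)}_\bot \circ \phi_n^p$, where $\phi$ and $\gamma$ are the chosen $\mathbf{O}$-colimits for $F_D$ and $F_{D'}$, and $\eta^{(n)} : F_D^n \Rightarrow F_{D'}^n$ is the $n$-fold horizontal composite of $\eta = F(f,-) : F_D \Rightarrow F_{D'}$. **Proposition (Pairing identity, Bekič's rule).** Let $\mathbf{A}$, $\mathbf{B}$ and $\mathbf{C}$ be small $\mathbf{O}$-categories, and assume that $\mathbf{B}$ and $\mathbf{C}$ support canonical fixed points. Let arbitrary choices of initial objects and $\mathbf{O}$-colimits as above be made in $\mathbf{B}$, in $\mathbf{C}$ and in $\mathbf{B} \times \mathbf{C}$. Let $F : \mathbf{A} \times \mathbf{B} \times \mathbf{C} \to \mathbf{B}$ and $G : \mathbf{A} \times \mathbf{B} \times \mathbf{C} \to \mathbf{C}$ be locally continuous functors. Let $G^\dagger : \mathbf{A} \times \mathbf{B}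 \to \mathbf{C}$ be the dagger of $G$ regarded as a functor $(\mathbf{A} \times \mathbf{B}) \times \mathbf{C} \to \mathbf{C}$, and set $$H = F \circ \langle \mathrm{id}_{\mathbf{A} \times \mathbf{B}}, G^\dagger \rangle : \mathbf{A} \times \mathbf{B} \to \mathbf{B}.$$ Then there is a natural isomorphism $$\langle F, G \rangle^\dagger \;\cong\; \langle H^\dagger,\; G^\dagger \circ \langle \mathrm{id}_{\mathbf{A}}, H^\dagger \rangle \rangle : \mathbf{A} \to \mathbf{B} \times \mathbf{C}.$$ -/

import Mathlib

open CategoryTheory CategoryTheory.Limits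

universe v v₁ v₂ v₃ u u₁ u₂ u₃

namespace OCat

/-- An `O`-category: every hom-set is a dcpo (every nonempty directed subset has a supremum) and
composition is jointly Scott-continuous. -/
class OCategory (K : Type u) [Category.{v} K] where
  /-- The order on each hom-set. -/
  homOrder : ∀ X Y : K, PartialOrder (X ⟶ Y)
  exists_isLUB : ∀ {X Y : K} (d : Set (X ⟶ Y)), d.Nonempty → DirectedOn (· ≤ ·) d →
    ∃ s : X ⟶ Y, IsLUB d s
  comp_continuous : ∀ X Y Z : K,
    ScottContinuous (fun q : (X ⟶ Y) × (Y ⟶ Z) => q.1 ≫ q.2)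

attribute [reducible, instance] OCategory.homOrder

section Basic

variable {K : Type u} [Category.{v} K] [OCategory K]

theorem comp_mono {X Y Z : K} {f f' : X ⟶ Y} {g g' : Y ⟶ Z} (hf : f ≤ f') (hg : g ≤ g') :
    f ≫ g ≤ f' ≫ g' :=
  (OCategory.comp_continuous X Y Z).monotone (show (f, g) ≤ (f', g') from ⟨hf, hg⟩)

theorem comp_right_continuous {X Y Z : K} (f : X ⟶ Y) :
    ScottContinuous (fun g : Y ⟶ Z => f ≫ g) :=
  ScottContinuous.comp (g := fun q : (X ⟶ Y) × (Y ⟶ Z) => q.1 ≫ q.2)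
    (ScottContinuous.prodMk (ScottContinuous.const f) ScottContinuous.id)
    (OCategory.comp_continuous X Y Z)

theorem comp_left_continuous {X Y Z : K} (g : Y ⟶ Z) :
    ScottContinuous (fun f : X ⟶ Y => f ≫ g) :=
  ScottContinuous.comp (g := fun q : (X ⟶ Y) × (Y ⟶ Z) => q.1 ≫ q.2)
    (ScottContinuous.prodMk ScottContinuous.id (ScottContinuous.const g))
    (OCategory.comp_continuous X Y Z)

/-- `(e, p)` is an embedding-projection pair. -/
structure IsEPPair {X Y : K} (e : X ⟶ Y) (p : Y ⟶ X) : Prop where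
  comp_eq : e ≫ p = 𝟙 X
  comp_le : p ≫ e ≤ 𝟙 Y

/-- `e` is an embedding. -/
def IsEmbedding {X Y : K} (e : X ⟶ Y) : Prop := ∃ p : Y ⟶ X, IsEPPair e p

/-- The projection associated with an embedding; it is unique by `IsEPPair.unique`. -/
noncomputable def IsEmbedding.proj {X Y : K} {e : X ⟶ Y} (h : IsEmbedding e) : Y ⟶ X :=
  Classical.choose h

theorem IsEmbedding.isEPPair {X Y : K} {e : X ⟶ Y} (h : IsEmbedding e) : IsEPPair e h.proj :=
  Classical.choose_spec h

theorem IsEPPair.le {X Y : K} {e : X ⟶ Y} {p q : Y ⟶ X} (hp : IsEPPair e p)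
    (hq : IsEPPair e q) : p ≤ q := by
  have h := comp_mono hp.comp_le (le_refl q)
  rw [Category.assoc, hq.comp_eq, Category.comp_id, Category.id_comp] at h
  exact h

theorem IsEPPair.unique {X Y : K} {e : X ⟶ Y} {p q : Y ⟶ X} (hp : IsEPPair e p)
    (hq : IsEPPair e q) : p = q :=
  le_antisymm (hp.le hq) (hq.le hp)

theorem IsEPPair.id (X : K) : IsEPPair (𝟙 X) (𝟙 X) := ⟨by simp, by simp⟩

theorem IsEPPair.comp {X Y Z : K} {e : X ⟶ Y} {p : Y ⟶ X} {e' : Y ⟶ Z} {p' : Z ⟶ Y}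
    (h : IsEPPair e p) (h' : IsEPPair e' p') : IsEPPair (e ≫ e') (p' ≫ p) where
  comp_eq := by
    rw [Category.assoc, ← Category.assoc e', h'.comp_eq, Category.id_comp, h.comp_eq]
  comp_le := by
    have h1 := comp_mono (le_refl p') (comp_mono h.comp_le (le_refl e'))
    rw [Category.id_comp] at h1
    simpa using h1.trans h'.comp_le

theorem IsEmbedding.comp {X Y Z : K} {e : X ⟶ Y} {e' : Y ⟶ Z}
    (h : IsEmbedding e) (h' : IsEmbedding e') : IsEmbedding (e ≫ e') :=
  ⟨_, h.isEPPair.comp h'.isEPPair⟩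

/-- An `ω`-chain of embeddings: an `ω`-chain all of whose morphisms lie in the subcategory of
embeddings. -/
def IsEmbeddingChain (J : ℕ ⥤ K) : Prop := ∀ ⦃m n : ℕ⦄ (f : m ⟶ n), IsEmbedding (J.map f)

/-- A cocone `κ` of embeddings is an `O`-colimit if the `κₙ ∘ κₙᵖ` form an ascending chain with
supremum the identity. -/
structure IsOColimit {J : ℕ ⥤ K} (κ : Cocone J) : Prop where
  isEmbedding : ∀ n, IsEmbedding (κ.ι.app n)
  monotone : Monotone fun n => (isEmbedding n).proj ≫ κ.ι.app n
  isLUB : IsLUB (Set.range fun n => (isEmbedding n).proj ≫ κ.ι.app n) (𝟙 κ.pt)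

variable (K)

/-- `K` has zero morphisms, and each of them is the least element of its hom-set. -/
def HasStrictMorphisms : Prop :=
  ∃ z : HasZeroMorphisms K, ∀ (X Y : K) (f : X ⟶ Y), (z.zero X Y).zero ≤ f

/-- Every `ω`-chain of embeddings has an `O`-colimit. -/
def OCocomplete : Prop :=
  ∀ J : ℕ ⥤ K, IsEmbeddingChain J → ∃ κ : Cocone J, IsOColimit κ

/-- `K` supports canonical fixed points. -/
class SupportsCFP : Prop where
  hasInitial : HasInitial K
  strict : HasStrictMorphisms K
  cocomplete : OCocomplete K

/-- A choice of an initial object and of an `O`-colimit for every `ω`-chain of embeddings. -/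
structure CFPChoice where
  /-- The chosen initial object. -/
  bot : K
  /-- Its initiality. -/
  isInitial : IsInitial bot
  /-- The chosen `O`-colimits. -/
  colim : ∀ J : ℕ ⥤ K, IsEmbeddingChain J → Cocone J
  isOColimit : ∀ (J : ℕ ⥤ K) (hJ : IsEmbeddingChain J), IsOColimit (colim J hJ)

instance [h : SupportsCFP K] : Nonempty (CFPChoice K) := by
  have := h.hasInitial
  exact ⟨⟨⊥_ K, initialIsInitial, fun J hJ => Classical.choose (h.cocomplete J hJ),
    fun J hJ => Classical.choose_spec (h.cocomplete J hJ)⟩⟩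

variable {K}

section Mediating

variable {J : ℕ ⥤ K} {κ : Cocone J}

theorem IsOColimit.monotone_desc (h : IsOColimit κ) (hJ : IsEmbeddingChain J) (s : Cocone J) :
    Monotone fun n => (h.isEmbedding n).proj ≫ s.ι.app n := by
  intro m n hmn
  have hj := hJ (homOfLE hmn)
  have e : (h.isEmbedding m).proj = (h.isEmbedding n).proj ≫ hj.proj := by
    refine (h.isEmbedding m).isEPPair.unique ?_
    have := hj.isEPPair.comp (h.isEmbedding n).isEPPair
    rwa [Cocone.w] at this
  have hs : s.ι.app m = J.map (homOfLE hmn) ≫ s.ι.app n := (Cocone.w s _).symm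
  have := comp_mono (le_refl (h.isEmbedding n).proj)
    (comp_mono hj.isEPPair.comp_le (le_refl (s.ι.app n)))
  simp only [Category.id_comp] at this
  simp only [e, hs]
  simpa using this

theorem IsOColimit.exists_desc (h : IsOColimit κ) (hJ : IsEmbeddingChain J) (s : Cocone J) :
    ∃ θ : κ.pt ⟶ s.pt, IsLUB (Set.range fun n => (h.isEmbedding n).proj ≫ s.ι.app n) θ :=
  OCategory.exists_isLUB _ (Set.range_nonempty _)
    (directedOn_range.2 (h.monotone_desc hJ s).directed_le)

/-- The mediating morphism `⨆ₙ sₙ ∘ κₙᵖ` from an `O`-colimit `κ` to a cocone `s`. -/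
noncomputable def IsOColimit.desc (h : IsOColimit κ) (hJ : IsEmbeddingChain J) (s : Cocone J) :
    κ.pt ⟶ s.pt :=
  Classical.choose (h.exists_desc hJ s)

theorem IsOColimit.isLUB_desc (h : IsOColimit κ) (hJ : IsEmbeddingChain J) (s : Cocone J) :
    IsLUB (Set.range fun n => (h.isEmbedding n).proj ≫ s.ι.app n) (h.desc hJ s) :=
  Classical.choose_spec (h.exists_desc hJ s)

theorem IsOColimit.fac (h : IsOColimit κ) (hJ : IsEmbeddingChain J) (s : Cocone J) (n : ℕ) :
    κ.ι.app n ≫ h.desc hJ s = s.ι.app n := by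
  have hm := h.monotone_desc hJ s
  have h1 := comp_right_continuous (κ.ι.app n) (Set.range_nonempty _)
    (directedOn_range.2 hm.directed_le) (h.isLUB_desc hJ s)
  have key : ∀ m, n ≤ m → κ.ι.app n ≫ (h.isEmbedding m).proj ≫ s.ι.app m = s.ι.app n := by
    intro m hnm
    rw [← Cocone.w κ (homOfLE hnm), Category.assoc, ← Category.assoc (κ.ι.app m),
      (h.isEmbedding m).isEPPair.comp_eq, Category.id_comp, Cocone.w]
  refine h1.unique ⟨?_, fun u hu => ?_⟩
  · rintro _ ⟨_, ⟨m, rfl⟩, rfl⟩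
    have := comp_mono (le_refl (κ.ι.app n)) (hm (le_max_right n m))
    rw [key _ (le_max_left n m)] at this
    exact this
  · have := hu ⟨_, ⟨n, rfl⟩, rfl⟩
    simp only [key n le_rfl] at this
    exact this

theorem IsOColimit.hom_ext (h : IsOColimit κ) {X : K} {f g : κ.pt ⟶ X}
    (w : ∀ n, κ.ι.app n ≫ f = κ.ι.app n ≫ g) : f = g := by
  have hf := comp_left_continuous f (Set.range_nonempty _)
    (directedOn_range.2 h.monotone.directed_le) h.isLUB
  have hg := comp_left_continuous g (Set.range_nonempty _)
    (directedOn_range.2 h.monotone.directed_le) h.isLUB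
  simp only [Category.id_comp] at hf hg
  refine hf.unique ?_
  convert hg using 1
  rw [← Set.range_comp, ← Set.range_comp]
  congr 1
  funext n
  simp [w n]

end Mediating

/-- The unique morphisms out of an initial object are embeddings. -/
theorem isEmbedding_to [h : SupportsCFP K] (c : CFPChoice K) (X : K) :
    IsEmbedding (c.isInitial.to X) := by
  obtain ⟨z, hz⟩ := h.strict
  refine ⟨0, c.isInitial.hom_ext _ _, ?_⟩
  rw [zero_comp]
  exact hz X X (𝟙 X)

end Basic

section Functors

variable {D : Type u₁} [Category.{v₁} D] [OCategory D]
variable {E : Type u₂} [Category.{v₂} E] [OCategory E]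
variable {K : Type u} [Category.{v} K] [OCategory K]

/-- A functor is locally continuous if its action on each hom-set is Scott-continuous. -/
def LocallyContinuous (D : Type u₁) [Category.{v₁} D] [OCategory D]
    (E : Type u₂) [Category.{v₂} E] [OCategory E] : ObjectProperty (D ⥤ E) :=
  fun F => ∀ X Y : D, ScottContinuous (fun f : X ⟶ Y => F.map f)

/-- The category of locally continuous functors and natural transformations. -/
abbrev LCFunctor (D : Type u₁) [Category.{v₁} D] [OCategory D]
    (E : Type u₂) [Category.{v₂} E] [OCategory E] :=
  (LocallyContinuous D E).FullSubcategory

theorem LCFunctor.isEPPair_map (F : LCFunctor D E) {X Y : D} {e : X ⟶ Y} {p : Y ⟶ X}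
    (h : IsEPPair e p) : IsEPPair (F.obj.map e) (F.obj.map p) where
  comp_eq := by rw [← F.obj.map_comp, h.comp_eq, F.obj.map_id]
  comp_le := by
    have := (F.property Y Y).monotone h.comp_le
    simpa using this

/-- The identity functor. -/
def LCFunctor.id (D : Type u₁) [Category.{v₁} D] [OCategory D] : LCFunctor D D :=
  ⟨𝟭 D, fun _ _ => ScottContinuous.id⟩

/-- The composite `G ∘ F`, written in diagrammatic order. -/
def LCFunctor.comp (F : LCFunctor D E) (G : LCFunctor E K) : LCFunctor D K :=
  ⟨F.obj ⋙ G.obj, fun X Y => ScottContinuous.comp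
    (g := fun f : F.obj.obj X ⟶ F.obj.obj Y => G.obj.map f) (F.property X Y) (G.property _ _)⟩

end Functors

section FIX

variable {K : Type u} [Category.{v} K] [OCategory K] (c : CFPChoice K)

/-- The objects `Fⁿ ⊥`. -/
def iter (F : K ⥤ K) : ℕ → K
  | 0 => c.bot
  | n + 1 => F.obj (iter F n)

/-- The morphisms `Fⁿ ⊥ : Fⁿ ⊥ ⟶ Fⁿ (F ⊥)`. -/
def iterStep (F : K ⥤ K) : ∀ n, iter c F n ⟶ iter c F (n + 1)
  | 0 => c.isInitial.to _
  | n + 1 => F.map (iterStep F n)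

/-- The `ω`-chain `⊥ ⟶ F ⊥ ⟶ F² ⊥ ⟶ ⋯`. -/
def chain (F : K ⥤ K) : ℕ ⥤ K := Functor.ofSequence (iterStep c F)

/-- The components at `⊥` of the horizontal iterates of `η`. -/
def iterMap {F G : K ⥤ K} (η : F ⟶ G) : ∀ n, iter c F n ⟶ iter c G n
  | 0 => 𝟙 _
  | n + 1 => F.map (iterMap η n) ≫ η.app (iter c G n)

theorem iterMap_step {F G : K ⥤ K} (η : F ⟶ G) (n : ℕ) :
    iterStep c F n ≫ iterMap c η (n + 1) = iterMap c η n ≫ iterStep c G n := by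
  induction n with
  | zero => exact c.isInitial.hom_ext _ _
  | succ n ih =>
    change F.map (iterStep c F n) ≫ F.map (iterMap c η (n + 1)) ≫ η.app _ =
      (F.map (iterMap c η n) ≫ η.app _) ≫ G.map (iterStep c G n)
    rw [← Category.assoc, ← F.map_comp, ih, F.map_comp, Category.assoc, Category.assoc,
      η.naturality]

/-- The morphism of `ω`-chains induced by `η`. -/
def chainMap {F G : K ⥤ K} (η : F ⟶ G) : chain c F ⟶ chain c G :=
  NatTrans.ofSequence (iterMap c η) (fun n => by
    unfold chain
    rw [Functor.ofSequence_map_homOfLE_succ, Functor.ofSequence_map_homOfLE_succ]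
    exact iterMap_step c η n)

theorem iterMap_id (F : K ⥤ K) (n : ℕ) : iterMap c (𝟙 F) n = 𝟙 _ := by
  induction n with
  | zero => rfl
  | succ n ih => simp only [iterMap, ih]; simp [iter]

theorem iterMap_comp {F G H : K ⥤ K} (η : F ⟶ G) (ρ : G ⟶ H) (n : ℕ) :
    iterMap c (η ≫ ρ) n = iterMap c η n ≫ iterMap c ρ n := by
  induction n with
  | zero => exact (Category.id_comp _).symm
  | succ n ih =>
    change F.map (iterMap c (η ≫ ρ) n) ≫ η.app _ ≫ ρ.app _ =
      (F.map (iterMap c η n) ≫ η.app _) ≫ G.map (iterMap c ρ n) ≫ ρ.app _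
    rw [ih, F.map_comp, Category.assoc, Category.assoc, η.naturality_assoc]

variable [SupportsCFP K]

theorem isEmbedding_iterStep (F : LCFunctor K K) (n : ℕ) : IsEmbedding (iterStep c F.obj n) := by
  induction n with
  | zero => exact isEmbedding_to c _
  | succ n ih => exact ⟨_, F.isEPPair_map ih.isEPPair⟩

theorem isEmbeddingChain_chain (F : LCFunctor K K) : IsEmbeddingChain (chain c F.obj) := by
  intro m n f
  obtain ⟨k, rfl⟩ := Nat.exists_eq_add_of_le (leOfHom f)
  obtain rfl := Subsingleton.elim f (homOfLE (by lia))
  induction k with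
  | zero =>
    have : (homOfLE (by lia) : m ⟶ m + 0) = 𝟙 m := Subsingleton.elim _ _
    rw [this, (chain c F.obj).map_id]
    exact ⟨_, IsEPPair.id _⟩
  | succ k ih =>
    have : (homOfLE (by lia) : m ⟶ m + (k + 1)) =
        (homOfLE (by lia) : m ⟶ m + k) ≫ homOfLE (Nat.le_add_right (m + k) 1) :=
      Subsingleton.elim _ _
    rw [this, (chain c F.obj).map_comp]
    refine ih.comp ?_
    unfold chain
    rw [Functor.ofSequence_map_homOfLE_succ]
    exact isEmbedding_iterStep c F _

/-- The chosen `O`-colimit of `⊥ ⟶ F ⊥ ⟶ F² ⊥ ⟶ ⋯`. -/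
def fixCocone (F : LCFunctor K K) : Cocone (chain c F.obj) :=
  c.colim _ (isEmbeddingChain_chain c F)

theorem isOColimit_fixCocone (F : LCFunctor K K) : IsOColimit (fixCocone c F) :=
  c.isOColimit _ _

/-- The components of the chosen `O`-colimit. -/
def fixι (F : LCFunctor K K) (n : ℕ) : iter c F.obj n ⟶ (fixCocone c F).pt :=
  (fixCocone c F).ι.app n

/-- The cocone `γₙ ∘ η⁽ⁿ⁾` under the chain of `F`, with `γ` the chosen `O`-colimit for `G`. -/
def fixMapCocone {F G : LCFunctor K K} (η : F ⟶ G) : Cocone (chain c F.obj) where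
  pt := (fixCocone c G).pt
  ι := chainMap c η.hom ≫ (fixCocone c G).ι

/-- The morphism `⨆ₙ γₙ ∘ η⁽ⁿ⁾ ∘ φₙᵖ`, with `φ` and `γ` the chosen `O`-colimits for `F` and
`G`. -/
noncomputable def fixMap {F G : LCFunctor K K} (η : F ⟶ G) :
    (fixCocone c F).pt ⟶ (fixCocone c G).pt :=
  (isOColimit_fixCocone c F).desc (isEmbeddingChain_chain c F) (fixMapCocone c η)

theorem fixι_fixMap {F G : LCFunctor K K} (η : F ⟶ G) (n : ℕ) :
    fixι c F n ≫ fixMap c η = iterMap c η.hom n ≫ fixι c G n :=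
  (isOColimit_fixCocone c F).fac (isEmbeddingChain_chain c F) (fixMapCocone c η) n

theorem fix_hom_ext {F : LCFunctor K K} {X : K} {f g : (fixCocone c F).pt ⟶ X}
    (w : ∀ n, fixι c F n ≫ f = fixι c F n ≫ g) : f = g :=
  (isOColimit_fixCocone c F).hom_ext w

/-- The canonical-fixed-point functor: on objects the chosen `O`-colimit of
`⊥ ⟶ F ⊥ ⟶ F² ⊥ ⟶ ⋯`, on morphisms `η ↦ ⨆ₙ γₙ ∘ η⁽ⁿ⁾ ∘ φₙᵖ`. -/
noncomputable def FIX : LCFunctor K K ⥤ K where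
  obj F := (fixCocone c F).pt
  map η := fixMap c η
  map_id F := by
    refine fix_hom_ext c fun n => ?_
    rw [fixι_fixMap]
    change iterMap c (𝟙 F.obj) n ≫ _ = _
    rw [iterMap_id, Category.comp_id, Category.id_comp]
  map_comp {F G H} η ρ := by
    refine fix_hom_ext c fun n => ?_
    rw [fixι_fixMap]
    change iterMap c (η.hom ≫ ρ.hom) n ≫ _ = _
    rw [iterMap_comp, ← Category.assoc, fixι_fixMap, Category.assoc, Category.assoc, fixι_fixMap]

end FIX

section Products

variable {A : Type u₁} [Category.{v₁} A] [OCategory A]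
variable {B : Type u₂} [Category.{v₂} B] [OCategory B]
variable {C : Type u₃} [Category.{v₃} C] [OCategory C]

/-- Hom-sets of a product category carry the product order. -/
instance : OCategory (B × C) where
  homOrder X Y := inferInstanceAs (PartialOrder ((X.1 ⟶ Y.1) × (X.2 ⟶ Y.2)))
  exists_isLUB {X Y} d hne hd := by
    obtain ⟨s, hs⟩ := OCategory.exists_isLUB (Prod.fst '' d) (hne.image _)
      (hd.mono_comp fun _ _ h => h.1)
    obtain ⟨t, ht⟩ := OCategory.exists_isLUB (Prod.snd '' d) (hne.image _)
      (hd.mono_comp fun _ _ h => h.2)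
    exact ⟨(s, t), isLUB_prod.2 ⟨hs, ht⟩⟩
  comp_continuous X Y Z := by
    refine ScottContinuous.prodMk
      (f := fun q : ((X.1 ⟶ Y.1) × (X.2 ⟶ Y.2)) × ((Y.1 ⟶ Z.1) × (Y.2 ⟶ Z.2)) =>
        q.1.1 ≫ q.2.1)
      (g := fun q => q.1.2 ≫ q.2.2) ?_ ?_
    · exact ScottContinuous.comp (g := fun q : (X.1 ⟶ Y.1) × (Y.1 ⟶ Z.1) => q.1 ≫ q.2)
        (f := fun q : ((X.1 ⟶ Y.1) × (X.2 ⟶ Y.2)) × ((Y.1 ⟶ Z.1) × (Y.2 ⟶ Z.2)) =>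
          (q.1.1, q.2.1)) (by fun_prop) (OCategory.comp_continuous _ _ _)
    · exact ScottContinuous.comp (g := fun q : (X.2 ⟶ Y.2) × (Y.2 ⟶ Z.2) => q.1 ≫ q.2)
        (f := fun q : ((X.1 ⟶ Y.1) × (X.2 ⟶ Y.2)) × ((Y.1 ⟶ Z.1) × (Y.2 ⟶ Z.2)) =>
          (q.1.2, q.2.2)) (by fun_prop) (OCategory.comp_continuous _ _ _)

theorem isEPPair_prod {X Y : B × C} {e : X ⟶ Y} {p : Y ⟶ X} :
    IsEPPair e p ↔ IsEPPair e.1 p.1 ∧ IsEPPair e.2 p.2 :=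
  ⟨fun h => ⟨⟨congrArg Prod.fst h.comp_eq, h.comp_le.1⟩,
    ⟨congrArg Prod.snd h.comp_eq, h.comp_le.2⟩⟩,
   fun h => ⟨Prod.ext h.1.comp_eq h.2.comp_eq, ⟨h.1.comp_le, h.2.comp_le⟩⟩⟩

/-- Products of categories supporting canonical fixed points support canonical fixed points. -/
instance [hB : SupportsCFP B] [hC : SupportsCFP C] : SupportsCFP (B × C) where
  hasInitial := by
    have := hB.hasInitial
    have := hC.hasInitial
    exact (IsInitial.ofUniqueHom (X := ((⊥_ B, ⊥_ C) : B × C))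
      (fun Y => (initial.to Y.1, initial.to Y.2))
      (fun Y m => Prod.ext (initialIsInitial.hom_ext _ _)
        (initialIsInitial.hom_ext _ _))).hasInitial
  strict := by
    obtain ⟨z, hz⟩ := hB.strict
    obtain ⟨w, hw⟩ := hC.strict
    exact ⟨{ zero := fun X Y => ⟨((z.zero X.1 Y.1).zero, (w.zero X.2 Y.2).zero)⟩
             comp_zero := fun f Z => Prod.ext (z.comp_zero f.1 Z.1) (w.comp_zero f.2 Z.2)
             zero_comp := fun X _ _ f => Prod.ext (z.zero_comp X.1 f.1) (w.zero_comp X.2 f.2) },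
      fun X Y f => ⟨hz _ _ f.1, hw _ _ f.2⟩⟩
  cocomplete J hJ := by
    obtain ⟨κ, hκ⟩ := hB.cocomplete (J ⋙ CategoryTheory.Prod.fst B C)
      (fun m n f => ⟨(hJ f).proj.1, (isEPPair_prod.1 (hJ f).isEPPair).1⟩)
    obtain ⟨τ, hτ⟩ := hC.cocomplete (J ⋙ CategoryTheory.Prod.snd B C)
      (fun m n f => ⟨(hJ f).proj.2, (isEPPair_prod.1 (hJ f).isEPPair).2⟩)
    let σ : Cocone J :=
      { pt := (κ.pt, τ.pt)
        ι := { app := fun n => (κ.ι.app n, τ.ι.app n)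
               naturality := fun m n f => Prod.ext (κ.ι.naturality f) (τ.ι.naturality f) } }
    have hep : ∀ n, IsEPPair (σ.ι.app n)
        ((hκ.isEmbedding n).proj, (hτ.isEmbedding n).proj) := fun n =>
      isEPPair_prod.2 ⟨(hκ.isEmbedding n).isEPPair, (hτ.isEmbedding n).isEPPair⟩
    have hemb : ∀ n, IsEmbedding (σ.ι.app n) := fun n => ⟨_, hep n⟩
    have heq : ∀ n, (hemb n).proj ≫ σ.ι.app n =
        ((hκ.isEmbedding n).proj ≫ κ.ι.app n, (hτ.isEmbedding n).proj ≫ τ.ι.app n) := fun n => by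
      rw [(hemb n).isEPPair.unique (hep n)]
      rfl
    refine ⟨σ, hemb, ?_, ?_⟩
    · intro m n hmn
      simp only [heq]
      exact ⟨hκ.monotone hmn, hτ.monotone hmn⟩
    · simp only [heq]
      refine isLUB_prod.2 ⟨?_, ?_⟩
      · rw [← Set.range_comp]
        exact hκ.isLUB
      · rw [← Set.range_comp]
        exact hτ.isLUB

/-- The pairing `⟨F, G⟩`. -/
def LCFunctor.pair (F : LCFunctor A B) (G : LCFunctor A C) : LCFunctor A (B × C) :=
  ⟨F.obj.prod' G.obj, fun X Y => ScottContinuous.prodMk (F.property X Y) (G.property X Y)⟩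

variable (A B C) in
/-- The associator `(A × B) × C ⟶ A × (B × C)`. -/
def LCFunctor.assoc : LCFunctor ((A × B) × C) (A × (B × C)) :=
  ⟨prod.associator A B C, fun X Y => by
    change ScottContinuous
      (fun q : ((X.1.1 ⟶ Y.1.1) × (X.1.2 ⟶ Y.1.2)) × (X.2 ⟶ Y.2) => (q.1.1, (q.1.2, q.2)))
    fun_prop⟩

end Products

section Dagger

variable {D : Type u₁} [Category.{v₁} D] [OCategory D]
variable {E : Type u₂} [Category.{v₂} E] [OCategory E]

/-- The functor `D ↦ F(D, -)`. -/
def Lam (F : LCFunctor (D × E) E) : D ⥤ LCFunctor E E :=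
  ObjectProperty.lift _ (Functor.curry.obj F.obj) (fun d X Y => by
    refine ScottContinuous.comp (f := fun f : X ⟶ Y => ((𝟙 d, f) : (d, X) ⟶ (d, Y)))
      (g := fun q : (d, X) ⟶ (d, Y) => F.obj.map q) ?_ (F.property _ _)
    exact ScottContinuous.prodMk (ScottContinuous.const (𝟙 d)) ScottContinuous.id)

variable (c : CFPChoice E)

theorem iterMap_Lam_continuous (F : LCFunctor (D × E) E) (X Y : D) (n : ℕ) :
    ScottContinuous (fun f : X ⟶ Y => iterMap c ((Lam F).map f).hom n) := by
  induction n with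
  | zero => exact ScottContinuous.const _
  | succ n ih =>
    have h : (fun f : X ⟶ Y => iterMap c ((Lam F).map f).hom (n + 1)) = fun f =>
        F.obj.map (X := (X, iter c ((Lam F).obj X).obj n)) (Y := (Y, iter c ((Lam F).obj Y).obj n))
          (f, iterMap c ((Lam F).map f).hom n) := by
      funext f
      change F.obj.map (X := (X, _)) (Y := (X, _)) (𝟙 X, iterMap c ((Lam F).map f).hom n) ≫
        F.obj.map (X := (X, _)) (Y := (Y, _)) (f, 𝟙 _) = _
      rw [← F.obj.map_comp]
      congr 1
      exact Prod.ext (Category.id_comp _) (Category.comp_id _)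
    rw [h]
    exact ScottContinuous.comp (ScottContinuous.prodMk ScottContinuous.id ih)
      (F.property (X, iter c ((Lam F).obj X).obj n) (Y, iter c ((Lam F).obj Y).obj n))

variable [SupportsCFP E]

/-- The dagger `F† : D ⟶ E` of `F : D × E ⟶ E`, namely `FIX ∘ ΛF`; so `F† D` is the canonical
fixed point of `F(D, -)`. -/
noncomputable def dagger (F : LCFunctor (D × E) E) : LCFunctor D E :=
  ⟨Lam F ⋙ FIX c, fun X Y => by
    have hcont : ∀ n, ScottContinuous (fun f : X ⟶ Y =>
        ((isOColimit_fixCocone c ((Lam F).obj X)).isEmbedding n).proj ≫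
          (fixMapCocone c ((Lam F).map f)).ι.app n) := fun n =>
      ScottContinuous.comp
        (ScottContinuous.comp (iterMap_Lam_continuous c F X Y n)
          (comp_left_continuous (fixι c ((Lam F).obj Y) n)))
        (comp_right_continuous
          ((isOColimit_fixCocone c ((Lam F).obj X)).isEmbedding n).proj)
    have hlub : ∀ f : X ⟶ Y, IsLUB _ (fixMap c ((Lam F).map f)) := fun f =>
      (isOColimit_fixCocone c ((Lam F).obj X)).isLUB_desc
        (isEmbeddingChain_chain c ((Lam F).obj X)) (fixMapCocone c ((Lam F).map f))
    intro d hne hd a ha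
    refine ⟨?_, fun u hu => ?_⟩
    · rintro _ ⟨f, hf, rfl⟩
      refine (hlub f).2 ?_
      rintro _ ⟨n, rfl⟩
      exact ((hcont n).monotone (ha.1 hf)).trans ((hlub a).1 ⟨n, rfl⟩)
    · refine (hlub a).2 ?_
      rintro _ ⟨n, rfl⟩
      refine (hcont n hne hd ha).2 ?_
      rintro _ ⟨f, hf, rfl⟩
      exact ((hlub f).1 ⟨n, rfl⟩).trans (hu ⟨f, hf, rfl⟩)⟩

end Dagger

section Bekic

variable {A : Type u₁} [Category.{v₁} A] [OCategory A]
variable {B : Type u₂} [Category.{v₂} B] [OCategory B]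
variable {C : Type u₃} [Category.{v₃} C] [OCategory C] [SupportsCFP C]

/-- `G† : A × B ⟶ C` for `G : A × B × C ⟶ C`, with `A × B` as the parameter category. -/
noncomputable def daggerAssoc (cC : CFPChoice C) (G : LCFunctor (A × B × C) C) :
    LCFunctor (A × B) C :=
  dagger cC ((LCFunctor.assoc A B C).comp G)

/-- The functor `H = F ∘ ⟨id, G†⟩ : A × B ⟶ B`. -/
noncomputable def bekicH (cC : CFPChoice C) (F : LCFunctor (A × B × C) B)
    (G : LCFunctor (A × B × C) C) : LCFunctor (A × B) B :=
  (((LCFunctor.id (A × B)).pair (daggerAssoc cC G)).comp (LCFunctor.assoc A B C)).comp F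

end Bekic

end OCat

/-! Both sides carry the same universal property, and this determines a functor up to natural
isomorphism. For locally continuous `T`, the canonical fixed point of `T(d, -)` is an initial
algebra of `T(d, -)`, with structure maps natural in `d` (`daggerInitialAlgebraFamily`). Since `T(d,
-)` preserves the `O`-colimit of the chain of iterates, a morphism out of the fixed point is an
algebra morphism exactly when its restrictions to the iterates obey a recursion. That recursion
starts at the initial object, so it has exactly one solution.

Two natural families of initial algebras for the same `T` are naturally isomorphic
(`InitialAlgebraFamily.iso`), so the choices of initial objects and `O`-colimits play no role.

It remains to see that the right-hand side is a family of initial algebras for `⟨F, G⟩`, which needs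
neither order nor colimits (`InitialAlgebraFamily.bekic`). A morphism to an `⟨F, G⟩`-algebra `(X,
Y)` is a pair `(h, k)` solving two simultaneous equations. For fixed `h`, initiality of `Q = G†`
solves the second one uniquely for `k`. Substituting this `k` into the first makes `h` an algebra
morphism out of the initial algebra of `F ∘ ⟨id, Q⟩`, so `h` is unique too (`bekic_iff`). -/

namespace OCat

/-! ### Preservation of `O`-colimits by locally continuous functors. -/

section Preservation

variable {D : Type u₁} [Category.{v₁} D] [OCategory D]
variable {E : Type u₂} [Category.{v₂} E] [OCategory E]

theorem LCFunctor.isEmbedding_map (F : LCFunctor D E) {X Y : D} {e : X ⟶ Y}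
    (h : IsEmbedding e) : IsEmbedding (F.obj.map e) :=
  ⟨_, F.isEPPair_map h.isEPPair⟩

/-- Locally continuous functors preserve `O`-colimits. -/
theorem IsOColimit.mapCocone (F : LCFunctor D E) {J : ℕ ⥤ D} {κ : Cocone J}
    (h : IsOColimit κ) : IsOColimit (F.obj.mapCocone κ) := by
  have hemb : ∀ n, IsEmbedding ((F.obj.mapCocone κ).ι.app n) := fun n =>
    F.isEmbedding_map (h.isEmbedding n)
  have heq : (fun n => (hemb n).proj ≫ (F.obj.mapCocone κ).ι.app n) =
      fun n => F.obj.map ((h.isEmbedding n).proj ≫ κ.ι.app n) := by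
    funext n
    -- The chosen projection is known only through its defining property; uniqueness of projections
    -- identifies it with the image of the original one.
    rw [(hemb n).isEPPair.unique (F.isEPPair_map (h.isEmbedding n).isEPPair), F.obj.map_comp]
    rfl
  refine ⟨hemb, ?_, ?_⟩
  · rw [heq]
    exact (F.property _ _).monotone.comp h.monotone
  · rw [heq]
    have := F.property _ _ (Set.range_nonempty _) (directedOn_range.2 h.monotone.directed_le)
      h.isLUB
    rw [← Set.range_comp] at this
    exact F.obj.map_id κ.pt ▸ this

end Preservation

/-! ### Canonical fixed points as initial algebras. -/

section InitialAlgebra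

variable {K : Type u} [Category.{v} K] [OCategory K] (c : CFPChoice K)
variable (T : LCFunctor K K)

/-- A cocone under the chain of iterates from its components. -/
def coconeOfSteps {X : K} (s : ∀ n, iter c T.obj n ⟶ X)
    (hs : ∀ n, iterStep c T.obj n ≫ s (n + 1) = s n) : Cocone (chain c T.obj) where
  pt := X
  ι := NatTrans.ofSequence (F := chain c T.obj) (G := (Functor.const ℕ).obj X) s (fun n => by
    unfold chain
    rw [Functor.ofSequence_map_homOfLE_succ]
    exact (hs n).trans (Category.comp_id _).symm)

/-- A cocone under the image of the chain of iterates from its components. -/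
def mapCoconeOfSteps {X : K} (s : ∀ n, iter c T.obj (n + 1) ⟶ X)
    (hs : ∀ n, iterStep c T.obj (n + 1) ≫ s (n + 1) = s n) : Cocone (chain c T.obj ⋙ T.obj) where
  pt := X
  ι := NatTrans.ofSequence (F := chain c T.obj ⋙ T.obj) (G := (Functor.const ℕ).obj X) s
    (fun n => by
      unfold chain
      rw [Functor.comp_map, Functor.ofSequence_map_homOfLE_succ]
      exact (hs n).trans (Category.comp_id _).symm)

variable {T}

/-- The morphisms `Tⁿ ⊥ ⟶ X` induced by an algebra structure on `X`. -/
def iterDesc {X : K} (x : T.obj.obj X ⟶ X) : ∀ n, iter c T.obj n ⟶ X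
  | 0 => c.isInitial.to X
  | n + 1 => T.obj.map (iterDesc x n) ≫ x

theorem iterStep_iterDesc {X : K} (x : T.obj.obj X ⟶ X) (n : ℕ) :
    iterStep c T.obj n ≫ iterDesc c x (n + 1) = iterDesc c x n := by
  induction n with
  | zero => exact c.isInitial.hom_ext _ _
  | succ n ih =>
    change T.obj.map (iterStep c T.obj n) ≫ T.obj.map (iterDesc c x (n + 1)) ≫ x =
      T.obj.map (iterDesc c x n) ≫ x
    rw [← Category.assoc, ← T.obj.map_comp, ih]

variable [SupportsCFP K] (T)

theorem iterStep_fixι (n : ℕ) : iterStep c T.obj n ≫ fixι c T (n + 1) = fixι c T n := by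
  have h := (fixCocone c T).w (homOfLE (Nat.le_add_right n 1))
  have e : (chain c T.obj).map (homOfLE (Nat.le_add_right n 1)) = iterStep c T.obj n :=
    Functor.ofSequence_map_homOfLE_succ _ n
  rw [e] at h
  exact h

/-- The structure map `T (FIX T) ⟶ FIX T` of the canonical fixed point. -/
noncomputable def fixStr : T.obj.obj (fixCocone c T).pt ⟶ (fixCocone c T).pt :=
  ((isOColimit_fixCocone c T).mapCocone T).desc
    (fun _ _ f => T.isEmbedding_map (isEmbeddingChain_chain c T f))
    (mapCoconeOfSteps c T (fun n => fixι c T (n + 1)) (fun n => iterStep_fixι c T (n + 1)))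

/-- The index shift comes from comparing the image of the colimit cocone under `T` with that cocone
less its zeroth leg. -/
theorem map_fixι_fixStr (n : ℕ) :
    T.obj.map (fixι c T n) ≫ fixStr c T = fixι c T (n + 1) :=
  ((isOColimit_fixCocone c T).mapCocone T).fac
    (fun _ _ f => T.isEmbedding_map (isEmbeddingChain_chain c T f))
    (mapCoconeOfSteps c T (fun n => fixι c T (n + 1)) (fun n => iterStep_fixι c T (n + 1))) n

/-- As `T` preserves the `O`-colimit, the images of its legs are jointly epic. Identities out of `T
(FIX T)` are therefore tested on iterates. -/
theorem map_fix_hom_ext {X : K} {f g : T.obj.obj (fixCocone c T).pt ⟶ X}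
    (w : ∀ n, T.obj.map (fixι c T n) ≫ f = T.obj.map (fixι c T n) ≫ g) : f = g :=
  ((isOColimit_fixCocone c T).mapCocone T).hom_ext w

variable {T}

theorem map_fixι_fixStr_comp {X : K} (h : (fixCocone c T).pt ⟶ X) (n : ℕ) :
    T.obj.map (fixι c T n) ≫ fixStr c T ≫ h = fixι c T (n + 1) ≫ h := by
  rw [← map_fixι_fixStr]
  exact (Category.assoc _ _ _).symm

/-- The unique algebra morphism from the canonical fixed point to an algebra. -/
noncomputable def fixDesc {X : K} (x : T.obj.obj X ⟶ X) : (fixCocone c T).pt ⟶ X :=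
  (isOColimit_fixCocone c T).desc (isEmbeddingChain_chain c T)
    (coconeOfSteps c T (iterDesc c x) (iterStep_iterDesc c x))

theorem fixι_fixDesc {X : K} (x : T.obj.obj X ⟶ X) (n : ℕ) :
    fixι c T n ≫ fixDesc c x = iterDesc c x n :=
  (isOColimit_fixCocone c T).fac (isEmbeddingChain_chain c T)
    (coconeOfSteps c T (iterDesc c x) (iterStep_iterDesc c x)) n

theorem fixStr_fixDesc {X : K} (x : T.obj.obj X ⟶ X) :
    fixStr c T ≫ fixDesc c x = T.obj.map (fixDesc c x) ≫ x := by
  refine map_fix_hom_ext c T fun n => ?_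
  refine (map_fixι_fixStr_comp c _ n).trans ((fixι_fixDesc c x (n + 1)).trans ?_)
  rw [← Category.assoc, ← T.obj.map_comp, fixι_fixDesc]
  rfl

/-- The algebra equation, restricted along the legs, says that the `(n + 1)`-st restriction of `h`
is obtained from the `n`-th as in `iterDesc`. At `n = 0` initiality of `c.bot` leaves no choice. -/
theorem eq_fixDesc {X : K} (x : T.obj.obj X ⟶ X) {h : (fixCocone c T).pt ⟶ X}
    (hh : fixStr c T ≫ h = T.obj.map h ≫ x) : h = fixDesc c x := by
  refine fix_hom_ext c fun n => ?_
  rw [fixι_fixDesc]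
  induction n with
  | zero => exact c.isInitial.hom_ext _ _
  | succ n ih =>
    refine (map_fixι_fixStr_comp c h n).symm.trans ?_
    rw [hh, ← Category.assoc, ← T.obj.map_comp, ih]
    rfl

/-- This is the source of the naturality of the structure maps in the parameter, once `η` is the
action of `Lam` on a morphism of parameters. -/
theorem fixStr_fixMap {S : LCFunctor K K} (η : T ⟶ S) :
    fixStr c T ≫ fixMap c η = T.obj.map (fixMap c η) ≫ η.hom.app _ ≫ fixStr c S := by
  refine map_fix_hom_ext c T fun n => ?_
  refine (map_fixι_fixStr_comp c _ n).trans ((fixι_fixMap c η (n + 1)).trans ?_)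
  rw [← Category.assoc, ← T.obj.map_comp, fixι_fixMap, T.obj.map_comp, Category.assoc,
    η.hom.naturality_assoc, map_fixι_fixStr]
  exact Category.assoc _ _ _

end InitialAlgebra

/-! ### Parametrised initial algebras and their uniqueness. -/

section Parametrised

variable {D : Type u₁} [Category.{v₁} D] {E : Type u₂} [Category.{v₂} E]

/-- A functor `R : D ⥤ E` with structure maps `T(d, R d) ⟶ R d`, natural in `d`, that make each
`R d` an initial algebra of `T(d, -)`. -/
structure InitialAlgebraFamily (T : D × E ⥤ E) (R : D ⥤ E) where
  /-- The structure maps. -/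
  str : ∀ d, T.obj (d, R.obj d) ⟶ R.obj d
  str_naturality : ∀ {d d' : D} (f : d ⟶ d'),
    str d ≫ R.map f = T.map (X := (d, R.obj d)) (Y := (d', R.obj d')) (f, R.map f) ≫ str d'
  /-- The unique algebra morphism to an algebra. -/
  desc : ∀ {d : D} {X : E}, (T.obj (d, X) ⟶ X) → (R.obj d ⟶ X)
  fac : ∀ {d : D} {X : E} (x : T.obj (d, X) ⟶ X),
    str d ≫ desc x = T.map (X := (d, R.obj d)) (Y := (d, X)) (𝟙 d, desc x) ≫ x
  uniq : ∀ {d : D} {X : E} (x : T.obj (d, X) ⟶ X) (h : R.obj d ⟶ X),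
    str d ≫ h = T.map (X := (d, R.obj d)) (Y := (d, X)) (𝟙 d, h) ≫ x → h = desc x

theorem map_pair_comp {D' : Type u₃} [Category.{v₃} D'] (T : D × E ⥤ D') {a b d : D} {X Y Z : E}
    (f : a ⟶ b) (g : b ⟶ d) (h : X ⟶ Y) (k : Y ⟶ Z) :
    T.map (X := (a, X)) (Y := (b, Y)) (f, h) ≫ T.map (X := (b, Y)) (Y := (d, Z)) (g, k) =
      T.map (X := (a, X)) (Y := (d, Z)) (f ≫ g, h ≫ k) :=
  (T.map_comp (X := (a, X)) (Y := (b, Y)) (Z := (d, Z)) (f, h) (g, k)).symm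

namespace InitialAlgebraFamily

variable {T : D × E ⥤ E} {R S : D ⥤ E}

theorem hom_ext (r : InitialAlgebraFamily T R) {d : D} {X : E} (x : T.obj (d, X) ⟶ X)
    {h k : R.obj d ⟶ X}
    (hh : r.str d ≫ h = T.map (X := (d, R.obj d)) (Y := (d, X)) (𝟙 d, h) ≫ x)
    (hk : r.str d ≫ k = T.map (X := (d, R.obj d)) (Y := (d, X)) (𝟙 d, k) ≫ x) : h = k :=
  (r.uniq x h hh).trans (r.uniq x k hk).symm

/-- The comparison between two families of initial algebras. -/
def comparison (r : InitialAlgebraFamily T R) (s : InitialAlgebraFamily T S) : R ⟶ S where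
  app d := r.desc (s.str d)
  naturality d d' f := by
    -- Restricting the structure map of `S d'` along `f` gives a `T(d, -)`-algebra on `S d'`. Both
    -- sides of the naturality square are algebra morphisms into it from the initial algebra `R d`.
    refine r.hom_ext (T.map (X := (d, S.obj d')) (Y := (d', S.obj d')) (f, 𝟙 _) ≫ s.str d')
      ?_ ?_
    · rw [← Category.assoc, r.str_naturality, Category.assoc, r.fac, ← Category.assoc,
        ← Category.assoc, map_pair_comp, map_pair_comp]
      simp only [Category.id_comp, Category.comp_id]
    · rw [← Category.assoc, r.fac, Category.assoc, s.str_naturality, ← Category.assoc,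
        ← Category.assoc, map_pair_comp, map_pair_comp]
      simp only [Category.id_comp, Category.comp_id]

theorem comparison_comp_comparison (r : InitialAlgebraFamily T R)
    (s : InitialAlgebraFamily T S) : r.comparison s ≫ s.comparison r = 𝟙 R := by
  ext d
  refine r.hom_ext (r.str d) ?_ ?_
  · change r.str d ≫ r.desc (s.str d) ≫ s.desc (r.str d) =
      T.map (𝟙 d, r.desc (s.str d) ≫ s.desc (r.str d)) ≫ r.str d
    rw [← Category.assoc, r.fac, Category.assoc, s.fac, ← Category.assoc, map_pair_comp,
      Category.id_comp]
  · change r.str d ≫ 𝟙 _ = T.map (𝟙 (d, R.obj d)) ≫ r.str d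
    rw [T.map_id, Category.id_comp, Category.comp_id]

/-- Families of initial algebras are unique up to natural isomorphism. -/
def iso (r : InitialAlgebraFamily T R) (s : InitialAlgebraFamily T S) : R ≅ S where
  hom := r.comparison s
  inv := s.comparison r
  hom_inv_id := r.comparison_comp_comparison s
  inv_hom_id := s.comparison_comp_comparison r

end InitialAlgebraFamily

/-- The dagger of `T` is a family of initial algebras for `T`. -/
noncomputable def daggerInitialAlgebraFamily [OCategory D] [OCategory E] [SupportsCFP E]
    (c : CFPChoice E) (T : LCFunctor (D × E) E) :
    InitialAlgebraFamily T.obj (dagger c T).obj where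
  str d := fixStr c ((Lam T).obj d)
  str_naturality {d d'} f := by
    refine (fixStr_fixMap c ((Lam T).map f)).trans ?_
    rw [← Category.assoc]
    congr 1
    -- Acting in the second variable and then in the first is the joint action of `T` on `(f, R f)`.
    refine (map_pair_comp T.obj (𝟙 d) f (fixMap c ((Lam T).map f)) (𝟙 _)).trans ?_
    rw [Category.id_comp, Category.comp_id]
    rfl
  desc {d _} x := fixDesc c (T := (Lam T).obj d) x
  fac {d _} x := fixStr_fixDesc c (T := (Lam T).obj d) x
  uniq {d _} x _ hh := eq_fixDesc c (T := (Lam T).obj d) x hh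

end Parametrised

/-! ### Bekič's rule for families of initial algebras. -/

section Bekic

variable {A : Type u₁} [Category.{v₁} A] {B : Type u₂} [Category.{v₂} B]
variable {C : Type u₃} [Category.{v₃} C]

theorem map_triple_comp {K : Type u} [Category.{v} K] (T : A × B × C ⥤ K) {a a' a'' : A}
    {b b' b'' : B} {c c' c'' : C} (f : a ⟶ a') (f' : a' ⟶ a'') (g : b ⟶ b') (g' : b' ⟶ b'')
    (h : c ⟶ c') (h' : c' ⟶ c'') :
    T.map (X := (a, b, c)) (Y := (a', b', c')) (f, g, h) ≫
        T.map (X := (a', b', c')) (Y := (a'', b'', c'')) (f', g', h') =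
      T.map (X := (a, b, c)) (Y := (a'', b'', c'')) (f ≫ f', g ≫ g', h ≫ h') :=
  (T.map_comp (X := (a, b, c)) (Y := (a', b', c')) (Z := (a'', b'', c''))
    (f, g, h) (f', g', h')).symm

variable {F : A × B × C ⥤ B} {G : A × B × C ⥤ C} {Q : A × B ⥤ C} {P : A ⥤ B}

namespace InitialAlgebraFamily

section Inner

variable (q : InitialAlgebraFamily (prod.associator A B C ⋙ G) Q)

/-- The structure maps of a family of initial algebras parametrised by a product. -/
def innerStr (a : A) (b : B) : G.obj (a, b, Q.obj (a, b)) ⟶ Q.obj (a, b) := q.str (a, b)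

/-- The mediating morphisms of a family of initial algebras parametrised by a product. -/
def innerDesc {a : A} {b : B} {Y : C} (y : G.obj (a, b, Y) ⟶ Y) : Q.obj (a, b) ⟶ Y :=
  q.desc (d := (a, b)) y

theorem innerStr_naturality {a a' : A} {b b' : B} (f : a ⟶ a') (g : b ⟶ b') :
    q.innerStr a b ≫ Q.map (X := (a, b)) (Y := (a', b')) (f, g) =
      G.map (X := (a, b, Q.obj (a, b))) (Y := (a', b', Q.obj (a', b')))
        (f, g, Q.map (X := (a, b)) (Y := (a', b')) (f, g)) ≫ q.innerStr a' b' :=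
  q.str_naturality (d := (a, b)) (d' := (a', b')) (f, g)

theorem innerStr_innerDesc {a : A} {b : B} {Y : C} (y : G.obj (a, b, Y) ⟶ Y) :
    q.innerStr a b ≫ q.innerDesc y =
      G.map (X := (a, b, Q.obj (a, b))) (Y := (a, b, Y)) (𝟙 a, 𝟙 b, q.innerDesc y) ≫ y :=
  q.fac (d := (a, b)) y

theorem inner_hom_ext {a : A} {b : B} {Y : C} (y : G.obj (a, b, Y) ⟶ Y)
    {h k : Q.obj (a, b) ⟶ Y}
    (hh : q.innerStr a b ≫ h =
      G.map (X := (a, b, Q.obj (a, b))) (Y := (a, b, Y)) (𝟙 a, 𝟙 b, h) ≫ y)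
    (hk : q.innerStr a b ≫ k =
      G.map (X := (a, b, Q.obj (a, b))) (Y := (a, b, Y)) (𝟙 a, 𝟙 b, k) ≫ y) : h = k :=
  q.hom_ext (d := (a, b)) y hh hk

/-- Algebra morphisms out of an initial algebra over a morphism `g` of parameters factor through
the action of `Q` on `g`. -/
theorem map_innerDesc_iff {a : A} {b X : B} {Y : C} (y : G.obj (a, X, Y) ⟶ Y) (g : b ⟶ X)
    (k : Q.obj (a, b) ⟶ Y) :
    q.innerStr a b ≫ k =
        G.map (X := (a, b, Q.obj (a, b))) (Y := (a, X, Y)) (𝟙 a, g, k) ≫ y ↔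
      k = Q.map (X := (a, b)) (Y := (a, X)) (𝟙 a, g) ≫ q.innerDesc y := by
  have key : q.innerStr a b ≫ Q.map (X := (a, b)) (Y := (a, X)) (𝟙 a, g) ≫ q.innerDesc y =
      G.map (X := (a, b, Q.obj (a, b))) (Y := (a, X, Y))
        (𝟙 a, g, Q.map (X := (a, b)) (Y := (a, X)) (𝟙 a, g) ≫ q.innerDesc y) ≫ y := by
    rw [← Category.assoc, q.innerStr_naturality, Category.assoc, q.innerStr_innerDesc,
      ← Category.assoc, map_triple_comp, Category.comp_id, Category.comp_id]
  refine ⟨fun h => ?_, fun h => h ▸ key⟩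
  -- Restricting `y` along `g` makes `Y` an algebra of `G(a, b, -)`. Both `k` and the composite in
  -- `key` are algebra morphisms into it, so initiality at `(a, b)` equates them.
  refine q.inner_hom_ext (G.map (X := (a, b, Y)) (Y := (a, X, Y)) (𝟙 a, g, 𝟙 Y) ≫ y) ?_ ?_
  · rw [h, ← Category.assoc, map_triple_comp, Category.comp_id, Category.comp_id,
      Category.id_comp]
  · rw [key, ← Category.assoc, map_triple_comp, Category.comp_id, Category.comp_id,
      Category.id_comp]

end Inner

section Outer

variable (p : InitialAlgebraFamily (((𝟭 (A × B)).prod' Q ⋙ prod.associator A B C) ⋙ F) P)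

/-- The structure maps of a family of initial algebras for `F ∘ ⟨id, Q⟩`. -/
def outerStr (a : A) : F.obj (a, P.obj a, Q.obj (a, P.obj a)) ⟶ P.obj a := p.str a

/-- The mediating morphisms of a family of initial algebras for `F ∘ ⟨id, Q⟩`. -/
def outerDesc {a : A} {X : B} (x : F.obj (a, X, Q.obj (a, X)) ⟶ X) : P.obj a ⟶ X := p.desc x

theorem outerStr_naturality {a a' : A} (f : a ⟶ a') :
    p.outerStr a ≫ P.map f =
      F.map (X := (a, P.obj a, Q.obj (a, P.obj a))) (Y := (a', P.obj a', Q.obj (a', P.obj a')))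
        (f, P.map f, Q.map (X := (a, P.obj a)) (Y := (a', P.obj a')) (f, P.map f)) ≫
          p.outerStr a' :=
  p.str_naturality f

theorem eq_outerDesc_iff {a : A} {X : B} (x : F.obj (a, X, Q.obj (a, X)) ⟶ X)
    (h : P.obj a ⟶ X) :
    p.outerStr a ≫ h = F.map (X := (a, P.obj a, Q.obj (a, P.obj a))) (Y := (a, X, Q.obj (a, X)))
        (𝟙 a, h, Q.map (X := (a, P.obj a)) (Y := (a, X)) (𝟙 a, h)) ≫ x ↔
      h = p.outerDesc x :=
  ⟨p.uniq x h, fun e => e ▸ p.fac x⟩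

end Outer

variable (q : InitialAlgebraFamily (prod.associator A B C ⋙ G) Q)
  (p : InitialAlgebraFamily (((𝟭 (A × B)).prod' Q ⋙ prod.associator A B C) ⋙ F) P)

/-- The mediating morphism for `F ∘ ⟨id, Q⟩` induced by an algebra of `⟨F, G⟩`. -/
def bekicDesc {a : A} {X : B} {Y : C} (x : F.obj (a, X, Y) ⟶ X) (y : G.obj (a, X, Y) ⟶ Y) :
    P.obj a ⟶ X :=
  p.outerDesc
    (F.map (X := (a, X, Q.obj (a, X))) (Y := (a, X, Y)) (𝟙 a, 𝟙 X, q.innerDesc y) ≫ x)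

/-- The universal property of the pair of initial algebras, in components. -/
theorem bekic_iff {a : A} {X : B} {Y : C} (x : F.obj (a, X, Y) ⟶ X) (y : G.obj (a, X, Y) ⟶ Y)
    (h : P.obj a ⟶ X) (k : Q.obj (a, P.obj a) ⟶ Y) :
    (p.outerStr a ≫ h = F.map (X := (a, P.obj a, Q.obj (a, P.obj a))) (Y := (a, X, Y))
        (𝟙 a, h, k) ≫ x ∧
      q.innerStr a (P.obj a) ≫ k =
        G.map (X := (a, P.obj a, Q.obj (a, P.obj a))) (Y := (a, X, Y)) (𝟙 a, h, k) ≫ y) ↔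
    (h = q.bekicDesc p x y ∧
      k = Q.map (X := (a, P.obj a)) (Y := (a, X)) (𝟙 a, q.bekicDesc p x y) ≫ q.innerDesc y) := by
  have key : p.outerStr a ≫ h = F.map (X := (a, P.obj a, Q.obj (a, P.obj a))) (Y := (a, X, Y))
        (𝟙 a, h, Q.map (X := (a, P.obj a)) (Y := (a, X)) (𝟙 a, h) ≫ q.innerDesc y) ≫ x ↔
      h = q.bekicDesc p x y := by
    -- The algebra structure used in `bekicDesc` begins with `F` applied to `q.innerDesc y`;
    -- functoriality merges this with `F(1, h, Q(1, h))`, leaving the first equation with the solved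
    -- `k` in place.
    rw [bekicDesc, ← p.eq_outerDesc_iff, ← Category.assoc (F.map _), map_triple_comp,
      Category.comp_id, Category.comp_id]
  -- The second equation now reads as a formula for `k` in terms of `h`, so `k` can be eliminated.
  rw [q.map_innerDesc_iff y h k, ← key]
  constructor
  · rintro ⟨e, rfl⟩
    exact ⟨e, by rw [← key.1 e]⟩
  · rintro ⟨e, rfl⟩
    rw [← key.1 e]
    exact ⟨e, rfl⟩

/-- Bekič's rule for initial algebras: an initial algebra of `⟨F, G⟩` in two variables is obtained
by solving first for `G`, with solution `Q`, and then for `F ∘ ⟨id, Q⟩`. -/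
def bekic : InitialAlgebraFamily (F.prod' G) (P.prod' ((𝟭 A).prod' P ⋙ Q)) where
  str a := (p.outerStr a, q.innerStr a (P.obj a))
  str_naturality f := Prod.ext (p.outerStr_naturality f) (q.innerStr_naturality f (P.map f))
  desc {a X} x := (q.bekicDesc p (X := X.1) (Y := X.2) x.1 x.2,
    Q.map (X := (a, P.obj a)) (Y := (a, X.1)) (𝟙 a, q.bekicDesc p x.1 x.2) ≫ q.innerDesc x.2)
  fac x :=
    have e := (q.bekic_iff p x.1 x.2 _ _).2 ⟨rfl, rfl⟩
    Prod.ext e.1 e.2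
  uniq x h hh :=
    have e := (q.bekic_iff p x.1 x.2 h.1 h.2).1 ⟨congrArg Prod.fst hh, congrArg Prod.snd hh⟩
    Prod.ext e.1 e.2

end InitialAlgebraFamily

end Bekic

end OCat

theorem mainTheorem7
    {A : Type u₁} [Category.{v₁} A] [OCat.OCategory A]
    {B : Type u₂} [Category.{v₂} B] [OCat.OCategory B] [OCat.SupportsCFP B]
    {C : Type u₃} [Category.{v₃} C] [OCat.OCategory C] [OCat.SupportsCFP C]
    (cB : OCat.CFPChoice B) (cC : OCat.CFPChoice C) (cBC : OCat.CFPChoice (B × C))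
    (F : OCat.LCFunctor (A × B × C) B) (G : OCat.LCFunctor (A × B × C) C) :
    Nonempty (OCat.dagger cBC (F.pair G) ≅
      (OCat.dagger cB (OCat.bekicH cC F G)).pair
        (((OCat.LCFunctor.id A).pair (OCat.dagger cB (OCat.bekicH cC F G))).comp
          (OCat.daggerAssoc cC G))) :=
  -- Locally continuous functors form a full subcategory, so an isomorphism of the underlying
  -- functors suffices. Those functors, and those whose algebras are compared, agree with the ones
  -- in `bekic` by unfolding definitions.
  ⟨(OCat.LocallyContinuous A (B × C)).isoMk
    ((OCat.daggerInitialAlgebraFamily cBC (F.pair G)).iso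
      (OCat.InitialAlgebraFamily.bekic
        (OCat.daggerInitialAlgebraFamily cC ((OCat.LCFunctor.assoc A B C).comp G))
        (OCat.daggerInitialAlgebraFamily cB (OCat.bekicH cC F G))))⟩
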